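/- Let $\kappa$ be an algebraically closed field and $n\ge 0$ an integer. The group $GL_n=GL_n(\kappa)$ acts on $n\times n$ matrices over $\kappa$ by conjugation, $g\cdot x=gxg^{-1}$; the orbits of nilpotent matrices are called nilpotent orbits. For a partition $\pi=[n_1\ge\dots\ge n_p]$ of $n$ let $\mathcal O(\pi)$ be the orbit of the Jordan matrix $J_{n_1}\oplus\cdots\oplus J_{n_p}$ (nilpotent Jordan blocks). A partition $\pi_1=[a_1\ge a_2\ge\cdots]$ dominates $\pi_2=[b_1\ge b_2\ge\cdots]$ (both of $n$, extended by zeros) if $\sum_{i\le k}a_i\ge\sum_{i\le k}b_i$ for all $k$. A cocharacter is a homomorphism of algebraic groups $\lambda:\mathbb G_m\to GL_n$; $\lim_\lambda x$ exists and equals $y$ if $a\mapsto\lambda(a)\cdot x$ extends to a morphism from $\mathbb A^1$ to the space of $n\times n$ matrices with value $y$ at $0$. A nilpotent orbit $\mathcal O_2$ is $1$-accessible from a nilpotent orbit $\mathcal O_1$ if there are $x\in\mathcal O_1$ and a cocharacter $\lambda$ such that $\lim_\lambda x$ exists and lies in $\mathcal O_2$ (this does not depend on the choice of $x\in\mathcal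 O_1$); it is accessible from $\mathcal O_1$ if it is reached from $\mathcal O_1$ by a finite chain of such steps through nilpotent orbits. The dominance order on nilpotent orbits is defined by $\mathcal O_2\le\mathcal O_1$ if and only if $\overline{\mathcal O_2}\subseteq\overline{\mathcal O_1}$ (Zariski closures). **Theorem.** (1) If $\pi_1,\pi_2$ are partitions of $n$ and $\pi_1$ dominates $\pi_2$, then $\mathcal O(\pi_2)$ is $1$-accessible from $\mathcal O(\pi_1)$. (2) For nilpotent orbits $\mathcal O_1,\mathcal O_2$ of $GL_n$, $\mathcal O_2$ is accessible from $\mathcal O_1$ if and only if it is $1$-accessible from $\mathcal O_1$. (3) Accessibility is a partial order on the nilpotent orbits of $GL_n$, and it is the dominance order: $\mathcal O_2$ is accessible from $\mathcal O_1$ if and only if $\overline{\mathcal O_2}\subseteq\overline{\mathcal O_1}$. In terms of partitions: $\pi\mapsto\mathcal O(\pi)$ is a bijection from the partitions of $n$ to the nilpotent orbits, and $\mathcal O(\pi_2)$ is accessible from $\mathcal O(\pi_1)$ if and only if $\pi_1$ dominates $\pi_2$. -/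

import Mathlib

open scoped Polynomial LaurentPolynomial

namespace GLAccess

/-! ### Cocharacters of `GL_n` and limits along them -/

/-- A cocharacter of `GL_n` over an (algebraically closed) field `κ`: a homomorphism of algebraic
groups `𝔾ₘ → GL_n`, on `κ`-points. Being a morphism of varieties means that every matrix entry is
a Laurent polynomial in the coordinate of `𝔾ₘ`; since `λ(a)⁻¹ = λ(a⁻¹)`, the entries of the inverse
are then Laurent polynomials as well. -/
structure Cocharacter (κ : Type*) [Field κ] (n : ℕ) where
  toHom : κˣ →* GL (Fin n) κ
  regular : ∃ P : Matrix (Fin n) (Fin n) κ[T;T⁻¹], ∀ (a : κˣ) (i j : Fin n),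
    (toHom a : Matrix (Fin n) (Fin n) κ) i j = LaurentPolynomial.eval₂ (RingHom.id κ) a (P i j)

/-- `lim_{a → 0} λ(a) · x` exists and is equal to `y`, for the action of `GL_n` on matrices by
conjugation: the map `a ↦ λ(a) x λ(a)⁻¹` on `𝔾ₘ` extends to a morphism from the affine line to the
space of matrices, given by a matrix of polynomials, whose value at `0` is `y`. -/
def Cocharacter.HasLimit {κ : Type*} [Field κ] {n : ℕ} (lam : Cocharacter κ n)
    (x y : Matrix (Fin n) (Fin n) κ) : Prop :=
  ∃ P : Matrix (Fin n) (Fin n) κ[X],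
    (∀ a : κˣ, (lam.toHom a : Matrix (Fin n) (Fin n) κ) * x *
        ((lam.toHom a)⁻¹ : GL (Fin n) κ) = P.map (Polynomial.eval (a : κ))) ∧
    P.map (Polynomial.eval 0) = y

/-! ### Nilpotent orbits -/

/-- The orbit of the matrix `x` under conjugation by `GL_n`. -/
def conjOrbit {κ : Type*} [Field κ] {n : ℕ} (x : Matrix (Fin n) (Fin n) κ) :
    Set (Matrix (Fin n) (Fin n) κ) :=
  {y | ∃ g : GL (Fin n) κ,
    (g : Matrix (Fin n) (Fin n) κ) * x * (g⁻¹ : GL (Fin n) κ) = y}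

/-- The nilpotent orbits of `GL_n`: the `GL_n`-orbits of nilpotent matrices. -/
def NilpotentOrbit (κ : Type*) [Field κ] (n : ℕ) : Type _ :=
  {O : Set (Matrix (Fin n) (Fin n) κ) // ∃ x, IsNilpotent x ∧ O = conjOrbit x}

/-- The orbit `O₂` is `1`-accessible from the orbit `O₁`: some limit `lim_λ x` with `x ∈ O₁` lies
in `O₂`. This does not depend on the choice of `x` in `O₁`, see `oneAccessible_iff_forall`. -/
def OneAccessible {κ : Type*} [Field κ] {n : ℕ} (O₁ O₂ : NilpotentOrbit κ n) : Prop :=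
  ∃ x ∈ O₁.1, ∃ (lam : Cocharacter κ n), ∃ y ∈ O₂.1, lam.HasLimit x y

/-- The orbit `O₂` is accessible from the orbit `O₁`: there is a finite chain of `1`-accessible
steps (at least one) from `O₁` to `O₂`. -/
def Accessible {κ : Type*} [Field κ] {n : ℕ} : NilpotentOrbit κ n → NilpotentOrbit κ n → Prop :=
  Relation.TransGen OneAccessible

/-- Conjugating a cocharacter by `g ∈ GL_n`. -/
def Cocharacter.conj {κ : Type*} [Field κ] {n : ℕ} (lam : Cocharacter κ n) (g : GL (Fin n) κ) :
    Cocharacter κ n where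
  toHom := (MulAut.conj g).toMonoidHom.comp lam.toHom
  regular := by
    obtain ⟨P, hP⟩ := lam.regular
    refine ⟨(g : Matrix (Fin n) (Fin n) κ).map LaurentPolynomial.C * P *
      ((g⁻¹ : GL (Fin n) κ) : Matrix (Fin n) (Fin n) κ).map LaurentPolynomial.C, ?_⟩
    intro a i j
    simp [Matrix.mul_apply, hP, map_sum, Finset.sum_mul]

theorem Cocharacter.HasLimit.conj {κ : Type*} [Field κ] {n : ℕ} {lam : Cocharacter κ n}
    {x y : Matrix (Fin n) (Fin n) κ} (h : lam.HasLimit x y) (g : GL (Fin n) κ) :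
    (lam.conj g).HasLimit
      ((g : Matrix (Fin n) (Fin n) κ) * x * (g⁻¹ : GL (Fin n) κ))
      ((g : Matrix (Fin n) (Fin n) κ) * y * (g⁻¹ : GL (Fin n) κ)) := by
  obtain ⟨P, hP, hy⟩ := h
  have key : ∀ c : κ, ((g : Matrix (Fin n) (Fin n) κ).map Polynomial.C * P *
      ((g⁻¹ : GL (Fin n) κ) : Matrix (Fin n) (Fin n) κ).map Polynomial.C).map
        (Polynomial.eval c) = (g : Matrix (Fin n) (Fin n) κ) * P.map (Polynomial.eval c) *
          (g⁻¹ : GL (Fin n) κ) := by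
    intro c
    ext i j
    simp [Matrix.mul_apply, Polynomial.eval_finsetSum]
  refine ⟨_, fun a => ?_, by rw [key 0, hy]⟩
  rw [key, ← hP a]
  have e : (lam.conj g).toHom a = g * lam.toHom a * g⁻¹ := rfl
  have hg : ((g⁻¹ : GL (Fin n) κ) : Matrix (Fin n) (Fin n) κ) * g = 1 := g.inv_mul
  rw [e]
  simp only [mul_inv_rev, inv_inv, Units.val_mul]
  calc _ = (g : Matrix (Fin n) (Fin n) κ) * lam.toHom a *
        (((g⁻¹ : GL (Fin n) κ) : Matrix (Fin n) (Fin n) κ) * g) * x *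
        (((g⁻¹ : GL (Fin n) κ) : Matrix (Fin n) (Fin n) κ) * g) *
        ((lam.toHom a)⁻¹ : GL (Fin n) κ) * (g⁻¹ : GL (Fin n) κ) := by
        simp only [mul_assoc]
    _ = _ := by simp only [hg, mul_one, mul_assoc]

/-- `1`-accessibility does not depend on the representative of the first orbit. -/
theorem oneAccessible_iff_forall {κ : Type*} [Field κ] {n : ℕ} (O₁ O₂ : NilpotentOrbit κ n) :
    OneAccessible O₁ O₂ ↔
      ∀ x ∈ O₁.1, ∃ (lam : Cocharacter κ n), ∃ y ∈ O₂.1, lam.HasLimit x y := by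
  obtain ⟨_, x₁, h₁, rfl⟩ := O₁
  obtain ⟨_, x₂, h₂, rfl⟩ := O₂
  constructor
  · rintro ⟨_, ⟨g, rfl⟩, lam, _, ⟨k, rfl⟩, h⟩ _ ⟨g', rfl⟩
    refine ⟨lam.conj (g' * g⁻¹), _, ⟨g' * g⁻¹ * k, rfl⟩, ?_⟩
    have h' := h.conj (g' * g⁻¹)
    have hg : ((g⁻¹ : GL (Fin n) κ) : Matrix (Fin n) (Fin n) κ) * g = 1 := g.inv_mul
    have hg2 : ∀ M, ((g⁻¹ : GL (Fin n) κ) : Matrix (Fin n) (Fin n) κ) * (g * M) = M := by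
      intro M; rw [← mul_assoc, hg, one_mul]
    simp only [mul_inv_rev, inv_inv, Units.val_mul, mul_assoc, hg2] at h' ⊢
    exact h'
  · intro h
    have hx : x₁ ∈ conjOrbit x₁ := ⟨1, by simp⟩
    exact ⟨x₁, hx, h x₁ hx⟩

/-! ### The dominance (closure) order on orbits -/

/-- The Zariski closure of a set of `n × n` matrices: the matrices at which every polynomial in the
matrix entries that vanishes on `S` vanishes. -/
def zariskiClosure {κ : Type*} [Field κ] {n : ℕ} (S : Set (Matrix (Fin n) (Fin n) κ)) :
    Set (Matrix (Fin n) (Fin n) κ) :=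
  {x | ∀ p : MvPolynomial (Fin n × Fin n) κ,
    (∀ y ∈ S, MvPolynomial.eval (fun ij => y ij.1 ij.2) p = 0) →
      MvPolynomial.eval (fun ij => x ij.1 ij.2) p = 0}

/-- The dominance order on nilpotent orbits: `O₂ ≤ O₁` if the Zariski closure of `O₂` is contained
in the Zariski closure of `O₁`. -/
def ClosureLE {κ : Type*} [Field κ] {n : ℕ} (O₂ O₁ : NilpotentOrbit κ n) : Prop :=
  zariskiClosure O₂.1 ⊆ zariskiClosure O₁.1

/-! ### Partitions and Jordan matrices -/

/-- The parts of a partition in decreasing order. -/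
def sortedParts {n : ℕ} (π : n.Partition) : List ℕ := π.parts.sort (· ≥ ·)

/-- `π₁` dominates `π₂`: every sum of the `k` largest parts of `π₁` is at least the corresponding
sum for `π₂` (a partition is extended by zeros). -/
def Dominates {n : ℕ} (π₁ π₂ : n.Partition) : Prop :=
  ∀ k : ℕ, ((sortedParts π₂).take k).sum ≤ ((sortedParts π₁).take k).sum

/-- The nilpotent Jordan block of size `m`, with ones on the superdiagonal. -/
def jordanBlock (κ : Type*) [Field κ] (m : ℕ) : Matrix (Fin m) (Fin m) κ :=
  Matrix.of fun i j => if (j : ℕ) = i + 1 then 1 else 0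

theorem sum_sortedParts {n : ℕ} (π : n.Partition) :
    ∑ i : Fin (sortedParts π).length, (sortedParts π).get i = n := by
  have h : (sortedParts π).sum = n := by
    rw [← Multiset.sum_coe, sortedParts, Multiset.sort_eq, π.parts_sum]
  rw [← List.sum_ofFn, List.ofFn_get, h]

/-- The positions in the consecutive diagonal blocks, numbered from `0` to `n - 1`. -/
def blockEquiv {n : ℕ} (π : n.Partition) :
    ((i : Fin (sortedParts π).length) × Fin ((sortedParts π).get i)) ≃ Fin n :=
  finSigmaFinEquiv.trans (finCongr (sum_sortedParts π))

/-- The Jordan matrix `J_{n₁} ⊕ ⋯ ⊕ J_{n_p}` of the partition `n₁ ≥ ⋯ ≥ n_p`. -/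
def jordanMatrix (κ : Type*) [Field κ] {n : ℕ} (π : n.Partition) : Matrix (Fin n) (Fin n) κ :=
  Matrix.reindex (blockEquiv π) (blockEquiv π)
    (Matrix.blockDiagonal' fun i => jordanBlock κ ((sortedParts π).get i))

theorem jordanBlock_pow (κ : Type*) [Field κ] (m k : ℕ) :
    jordanBlock κ m ^ k = Matrix.of fun (i j : Fin m) => if (j : ℕ) = i + k then 1 else 0 := by
  induction k with
  | zero =>
    ext i j
    simp [Matrix.one_apply, Fin.ext_iff, eq_comm]
  | succ k ih =>
    ext i j
    rw [pow_succ, ih, Matrix.mul_apply]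
    simp only [Matrix.of_apply, jordanBlock, ite_mul, one_mul, zero_mul]
    by_cases h : (j : ℕ) = i + (k + 1)
    · rw [if_pos h, Finset.sum_eq_single ⟨i + k, by omega⟩]
      · simp only [if_true]
        rw [if_pos (by omega)]
      · intro b _ hb
        rw [if_neg (fun h' => hb (Fin.ext h'))]
      · simp
    · rw [if_neg h]
      refine Finset.sum_eq_zero fun b _ => ?_
      split_ifs <;> first | rfl | omega

theorem isNilpotent_jordanMatrix (κ : Type*) [Field κ] {n : ℕ} (π : n.Partition) :
    IsNilpotent (jordanMatrix κ π) := by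
  have h : ∀ (ι : Type) [Fintype ι] [DecidableEq ι] (e : ι ≃ Fin n) (M : Matrix ι ι κ),
      M ^ n = 0 → Matrix.reindex e e M ^ n = 0 := by
    intro ι _ _ e M hM
    have := map_pow (Matrix.reindexAlgEquiv κ κ e) M n
    rw [hM, map_zero] at this
    simpa using this.symm
  refine ⟨n, h _ _ _ ?_⟩
  rw [← Matrix.blockDiagonal'_pow]
  have : ((fun i => jordanBlock κ ((sortedParts π).get i)) ^ n :
      (i : Fin (sortedParts π).length) →
        Matrix (Fin ((sortedParts π).get i)) (Fin ((sortedParts π).get i)) κ) = 0 := by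
    funext i
    rw [Pi.pow_apply, jordanBlock_pow]
    ext a b
    have hle : (sortedParts π).get i ≤ n := by
      refine Nat.Partition.le_of_mem_parts (p := π) ?_
      rw [← Multiset.mem_sort (r := (· ≥ ·))]
      exact List.get_mem _ _
    simp only [Matrix.of_apply, Pi.zero_apply, Matrix.zero_apply]
    rw [if_neg (by omega)]
  rw [this, Matrix.blockDiagonal'_zero]

/-- The nilpotent orbit `𝒪(π)` labelled by the partition `π`: the orbit of its Jordan matrix. -/
def orbitOf (κ : Type*) [Field κ] {n : ℕ} (π : n.Partition) : NilpotentOrbit κ n :=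
  ⟨conjOrbit (jordanMatrix κ π), jordanMatrix κ π, isNilpotent_jordanMatrix κ π, rfl⟩

end GLAccess

/-! Write `f` for the nilpotent endomorphism given by a Jordan matrix of type `π₁`. If `π₁`
dominates `π₂`, with parts `b 0 ≥ b 1 ≥ ⋯`, then there is an `f`-stable flag whose successive
quotients are cyclic of dimensions `b j` (`exists_flag`). In an adapted basis the matrix is block
upper triangular, with the Jordan blocks of `π₂` on the diagonal. A diagonal cocharacter, constant
on blocks and with decreasing weights, contracts the part above the diagonal to zero, so its limit
is the Jordan matrix of `π₂`: one step suffices.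

The flag is built from its top quotient downwards. With `c` the smallest part of `π₂`, choose
consecutive Jordan strings of lengths `l m ≥ c ≥ l (m + 1)`. Their generators are traded for one
element `e` killed by `f ^ (l m + l (m + 1) - c)` and for `w m`, which has order at most `c` modulo
the stable span of `e`. The shorter list of lengths still dominates what remains of `π₂`, and
induction applies.

Conversely, a limit along a cocharacter lies in the Zariski closure of the orbit, and the ranks of
powers cannot go up in a closure. For a Jordan matrix these ranks are `∑ (π i - k)` with truncated
subtraction, and comparing them for all `k` gives dominance (`dominates_of_rank_le`). Since every
nilpotent matrix has a Jordan form, closure inclusion, dominance, `1`-accessibility and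
accessibility all agree; antisymmetry is that of dominance of partitions. -/

namespace GLAccess

/-! ### Stable flags with prescribed cyclic quotients -/

section Flags

variable {K V : Type*} [Field K] [AddCommGroup V] [Module K V]

/-- The smallest `f`-stable subspace containing `u 0, …, u (q - 1)`. -/
def stableSpan (f : Module.End K V) (u : ℕ → V) (q : ℕ) : Submodule K V :=
  Submodule.span K {x | ∃ i < q, ∃ a : ℕ, x = (f ^ a) (u i)}

theorem pow_mem_stableSpan (f : Module.End K V) (u : ℕ → V) {q i : ℕ} (h : i < q) (a : ℕ) :
    (f ^ a) (u i) ∈ stableSpan f u q :=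
  Submodule.subset_span ⟨i, h, a, rfl⟩

theorem mem_stableSpan (f : Module.End K V) (u : ℕ → V) {q i : ℕ} (h : i < q) :
    u i ∈ stableSpan f u q := by
  simpa using pow_mem_stableSpan f u h 0

theorem stableSpan_le_of_pow_mem {f : Module.End K V} {u : ℕ → V} {q : ℕ} {W : Submodule K V}
    (h : ∀ i < q, ∀ a : ℕ, (f ^ a) (u i) ∈ W) : stableSpan f u q ≤ W := by
  refine Submodule.span_le.2 ?_
  rintro _ ⟨i, hi, a, rfl⟩
  exact h i hi a

theorem pow_mem_of_stable {f : Module.End K V} {W : Submodule K V} (hW : ∀ x ∈ W, f x ∈ W)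
    {x : V} (hx : x ∈ W) (a : ℕ) : (f ^ a) x ∈ W := by
  induction a with
  | zero => simpa using hx
  | succ a ih => rw [pow_succ', Module.End.mul_apply]; exact hW _ ih

theorem stableSpan_stable (f : Module.End K V) (u : ℕ → V) (q : ℕ) :
    ∀ x ∈ stableSpan f u q, f x ∈ stableSpan f u q := by
  intro x hx
  have : stableSpan f u q ≤ (stableSpan f u q).comap f := by
    refine stableSpan_le_of_pow_mem fun i hi a => ?_
    have := pow_mem_stableSpan f u hi (a + 1)
    rwa [pow_succ', Module.End.mul_apply] at this
  exact this hx

theorem stableSpan_le {f : Module.End K V} {u : ℕ → V} {q : ℕ} {W : Submodule K V}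
    (hW : ∀ x ∈ W, f x ∈ W) (h : ∀ i < q, u i ∈ W) : stableSpan f u q ≤ W :=
  stableSpan_le_of_pow_mem fun i hi a => pow_mem_of_stable hW (h i hi) a

theorem stableSpan_mono (f : Module.End K V) (u : ℕ → V) {q r : ℕ} (h : q ≤ r) :
    stableSpan f u q ≤ stableSpan f u r :=
  stableSpan_le (stableSpan_stable f u r) fun _ hi => mem_stableSpan f u (hi.trans_le h)

theorem stableSpan_congr (f : Module.End K V) {u v : ℕ → V} {q : ℕ} (h : ∀ i < q, u i = v i) :
    stableSpan f u q = stableSpan f v q := by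
  apply le_antisymm <;> refine stableSpan_le (stableSpan_stable _ _ _) fun i hi => ?_
  · rw [h i hi]; exact mem_stableSpan f v hi
  · rw [← h i hi]; exact mem_stableSpan f u hi

/-- Two consecutive rows `l m ≥ c ≥ l (m + 1)` are merged into one row `l m + l (m + 1) - c`. -/
def mergeRows (l : ℕ → ℕ) (m c : ℕ) (i : ℕ) : ℕ :=
  if i < m then l i else if i = m then l m + l (m + 1) - c else l (i + 1)

/-- The bounds on `c` place the merged row `l m + l (m + 1) - c` between `l (m + 1)` and `l m`. -/
theorem mergeRows_antitone {l : ℕ → ℕ} (hl : Antitone l) {m c : ℕ} (h₁ : c ≤ l m)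
    (h₂ : l (m + 1) ≤ c) : Antitone (mergeRows l m c) := by
  refine antitone_nat_of_succ_le fun i => ?_
  have a1 := hl (Nat.le_succ i)
  have a2 := hl (Nat.le_succ (i + 1))
  simp only [Nat.succ_eq_add_one] at a1 a2
  unfold mergeRows
  rcases lt_trichotomy i m with h | h | h
  · rcases Nat.lt_or_ge (i + 1) m with h' | h'
    · simp [h, h', a1]
    · obtain rfl : m = i + 1 := by omega
      simp; omega
  · subst h
    simp; omega
  · rw [if_neg (by omega), if_neg (by omega), if_neg (by omega), if_neg (by omega)]
    exact a2

theorem sum_mergeRows_of_le (l : ℕ → ℕ) {m c k : ℕ} (h : k ≤ m) :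
    ∑ i ∈ Finset.range k, mergeRows l m c i = ∑ i ∈ Finset.range k, l i := by
  refine Finset.sum_congr rfl fun i hi => ?_
  rw [mergeRows, if_pos ((Finset.mem_range.1 hi).trans_le h)]

/-- Past the merge, `k` new rows account for `k + 1` old ones, less the `c` boxes removed. -/
theorem sum_mergeRows_of_lt (l : ℕ → ℕ) {m c k : ℕ} (h₁ : c ≤ l m) (h : m < k) :
    ∑ i ∈ Finset.range k, mergeRows l m c i + c = ∑ i ∈ Finset.range (k + 1), l i := by
  induction k, h using Nat.le_induction with
  | base =>
    rw [Finset.sum_range_succ, sum_mergeRows_of_le l le_rfl, Finset.sum_range_succ _ (m.succ),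
      Finset.sum_range_succ _ m]
    simp [mergeRows]
    omega
  | succ k hk ih =>
    rw [Finset.sum_range_succ, Finset.sum_range_succ _ (k + 1), ← ih]
    have : mergeRows l m c k = l (k + 1) := by
      rw [mergeRows, if_neg (by omega), if_neg (by omega)]
    omega

theorem exists_eq_zero_of_sum_le {l : ℕ → ℕ} {N : ℕ}
    (h : ∀ k, ∑ i ∈ Finset.range k, l i ≤ N) : ∃ k, l k = 0 := by
  by_contra! hne
  have := h (N + 1)
  have h2 : ∑ i ∈ Finset.range (N + 1), 1 ≤ ∑ i ∈ Finset.range (N + 1), l i :=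
    Finset.sum_le_sum fun i _ => Nat.one_le_iff_ne_zero.2 (hne i)
  simp at h2
  omega

/-- Generators `w i` of orders `l i`, where `l` dominates `b`, can be replaced by vectors
`u 0, …, u (q - 1)` generating a flag of stable subspaces with cyclic quotients of lengths `b j`. -/
theorem exists_flag (f : Module.End K V) (q : ℕ) (b l : ℕ → ℕ) (w : ℕ → V)
    (hb : Antitone b) (hl : Antitone l) (hw : ∀ i, (f ^ l i) (w i) = 0)
    (h₁ : ∀ k ≤ q, ∑ i ∈ Finset.range k, b i ≤ ∑ i ∈ Finset.range k, l i)
    (h₂ : ∀ k, ∑ i ∈ Finset.range k, l i ≤ ∑ i ∈ Finset.range q, b i) :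
    ∃ u : ℕ → V, (∀ j < q, (f ^ b j) (u j) ∈ stableSpan f u j) ∧
      ∀ i, w i ∈ stableSpan f u q := by
  induction q generalizing l w with
  | zero =>
    refine ⟨0, by simp, fun i => ?_⟩
    have h := h₂ (i + 1)
    rw [Finset.sum_range_succ] at h
    have hi : l i = 0 := by simp at h; omega
    have := hw i
    rw [hi] at this
    simp only [pow_zero, Module.End.one_apply] at this
    rw [this]
    exact zero_mem _
  | succ q ih =>
    -- Take the first `m` with `l (m + 1) ≤ b q`. Minimality gives `b q ≤ l m`, except for `m = 0`,
    -- where dominance gives `l 0 ≥ b 0 ≥ b q`.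
    obtain ⟨m, hm1, hm2⟩ : ∃ m, b q ≤ l m ∧ l (m + 1) ≤ b q := by
      have hex : ∃ j, l (j + 1) ≤ b q := by
        obtain ⟨k, hk⟩ := exists_eq_zero_of_sum_le h₂
        have := hl (Nat.le_succ k)
        exact ⟨k, by simp only [Nat.succ_eq_add_one] at this; omega⟩
      classical
      refine ⟨Nat.find hex, ?_, Nat.find_spec hex⟩
      rcases h : Nat.find hex with _ | j
      · have := h₁ 1 (by omega)
        have h0 := hb (Nat.zero_le q)
        simp at this
        omega
      · have := Nat.find_min hex (m := j) (by omega)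
        omega
    set c := b q with hc
    -- The exponent `c - l (m + 1)` is chosen so that `f ^ l (m + 1)` maps `e m` to `f ^ c (w m)`,
    -- the term in `w (m + 1)` being killed.
    set e : ℕ → V := fun i => if i < m then w i else
      if i = m then (f ^ (c - l (m + 1))) (w m) - w (m + 1) else w (i + 1) with he
    have e_lt : ∀ i < m, e i = w i := fun i hi => by simp [he, hi]
    have e_eq : e m = (f ^ (c - l (m + 1))) (w m) - w (m + 1) := by simp [he]
    have e_gt : ∀ i, m < i → e i = w (i + 1) := fun i hi => by
      simp only [he]; rw [if_neg (by omega), if_neg (by omega)]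
    obtain ⟨u, hu, hue⟩ := ih (mergeRows l m c) e (mergeRows_antitone hl hm1 hm2)
      (by
        intro i
        rcases lt_trichotomy i m with h | rfl | h
        · rw [e_lt i h, mergeRows, if_pos h, hw]
        · rw [e_eq, mergeRows, if_neg (lt_irrefl _), if_pos rfl, map_sub,
            ← Module.End.mul_apply, ← pow_add,
            show l i + l (i + 1) - c + (c - l (i + 1)) = l i by omega, hw,
            show l i + l (i + 1) - c = (l i - c) + l (i + 1) by omega, pow_add,
            Module.End.mul_apply, hw, map_zero, sub_zero]
        · rw [e_gt i h, mergeRows, if_neg (by omega), if_neg (by omega), hw])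
      (by
        intro k hk
        rcases Nat.lt_or_ge m k with h | h
        · have e1 := sum_mergeRows_of_lt l hm1 h
          -- Merging costs `c = b q` on the left, while the extra part `b k` on the right is at
          -- least `b q`.
          have e2 := h₁ (k + 1) (by omega)
          rw [Finset.sum_range_succ] at e2
          have := hb hk
          omega
        · rw [sum_mergeRows_of_le l h]
          exact h₁ k (by omega))
      (by
        intro k
        -- The range is lengthened beyond `m`, where the formula for merged sums applies.
        have e1 := sum_mergeRows_of_lt l hm1 (show m < k + m + 1 by omega)
        have e2 := h₂ (k + m + 1 + 1)
        rw [Finset.sum_range_succ _ q] at e2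
        have e3 : ∑ i ∈ Finset.range k, mergeRows l m c i ≤
            ∑ i ∈ Finset.range (k + m + 1), mergeRows l m c i :=
          Finset.sum_le_sum_of_subset (Finset.range_mono (by omega))
        omega)
    -- `w m` becomes the last generator; modulo the span of the earlier ones it is killed by `f ^
    -- c`.
    set v : ℕ → V := Function.update u q (w m) with hv
    have hvu : ∀ i < q, v i = u i := fun i hi => Function.update_of_ne (by omega) _ _
    have hvq : v q = w m := Function.update_self _ _ _
    have hS : ∀ j ≤ q, stableSpan f v j = stableSpan f u j := fun j hj =>
      stableSpan_congr f fun i hi => hvu i (by omega)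
    have hev : ∀ i, e i ∈ stableSpan f v (q + 1) := fun i =>
      stableSpan_mono f v (Nat.le_succ q) (by rw [hS q le_rfl]; exact hue i)
    refine ⟨v, fun j hj => ?_, fun i => ?_⟩
    · rw [hS j (by omega)]
      rcases Nat.lt_or_ge j q with h | h
      · rw [hvu j h]; exact hu j h
      · obtain rfl : j = q := by omega
        have : (f ^ c) (w m) = (f ^ l (m + 1)) (e m) := by
          rw [e_eq, map_sub, hw, sub_zero, ← Module.End.mul_apply, ← pow_add,
            Nat.add_sub_cancel' hm2]
        rw [hvq, ← hc, this]
        exact pow_mem_of_stable (stableSpan_stable _ _ _) (hue m) _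
    · have hwm : w m ∈ stableSpan f v (q + 1) := by
        rw [← hvq]; exact mem_stableSpan f v (Nat.lt_succ_self q)
      rcases Nat.lt_or_ge i m with h | h
      · rw [← e_lt i h]; exact hev i
      rcases eq_or_lt_of_le h with rfl | h
      · exact hwm
      rcases eq_or_lt_of_le (Nat.succ_le_of_lt h) with h' | h'
      · have : w i = (f ^ (c - l (m + 1))) (w m) - e m := by
          rw [e_eq, ← h', sub_sub_cancel]
        rw [this]
        exact sub_mem (pow_mem_of_stable (stableSpan_stable _ _ _) hwm _) (hev m)
      · obtain ⟨i, rfl⟩ : ∃ k, i = k + 1 := ⟨i - 1, by omega⟩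
        rw [← e_gt i (by omega)]
        exact hev i

end Flags

/-! ### Bases adapted to a flag -/

section FlagBasis

variable {K V : Type*} [Field K] [AddCommGroup V] [Module K V]

/-- Powers of `f` on `u j` from `b j` onwards fall into the stable span of the earlier generators,
which induction has already reduced. -/
theorem stableSpan_le_span (f : Module.End K V) (u : ℕ → V) (b : ℕ → ℕ) (q : ℕ)
    (h : ∀ j < q, (f ^ b j) (u j) ∈ stableSpan f u j) :
    stableSpan f u q ≤ Submodule.span K {x | ∃ i < q, ∃ a < b i, x = (f ^ a) (u i)} := by
  induction q with
  | zero => exact stableSpan_le_of_pow_mem fun i hi => absurd hi (Nat.not_lt_zero i)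
  | succ q ih =>
    have ih' := ih fun j hj => h j (hj.trans (Nat.lt_succ_self q))
    have mono : Submodule.span K {x | ∃ i < q, ∃ a < b i, x = (f ^ a) (u i)} ≤
        Submodule.span K {x | ∃ i < q + 1, ∃ a < b i, x = (f ^ a) (u i)} := by
      refine Submodule.span_mono ?_
      rintro _ ⟨i, hi, a, ha, rfl⟩
      exact ⟨i, by omega, a, ha, rfl⟩
    have key : ∀ a, (f ^ a) (u q) ∈
        Submodule.span K {x | ∃ i < q + 1, ∃ a < b i, x = (f ^ a) (u i)} := by
      intro a
      rcases Nat.lt_or_ge a (b q) with ha | ha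
      · exact Submodule.subset_span ⟨q, Nat.lt_succ_self q, a, ha, rfl⟩
      · obtain ⟨a, rfl⟩ := Nat.exists_eq_add_of_le' ha
        rw [pow_add, Module.End.mul_apply]
        exact mono (ih' (pow_mem_of_stable (stableSpan_stable f u q)
          (h q (Nat.lt_succ_self q)) a))
    refine stableSpan_le_of_pow_mem fun i hi a => ?_
    rcases Nat.lt_or_ge i q with hi' | hi'
    · exact mono (ih' (pow_mem_stableSpan f u hi' a))
    · obtain rfl : i = q := by omega
      exact key a

/-- A flag with cyclic quotients, generated by `u`, gives a basis adapted to it. -/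
theorem exists_flag_basis [FiniteDimensional K V] (f : Module.End K V) (u : ℕ → V) (q : ℕ)
    (b : ℕ → ℕ) (β : Fin q → ℕ) (hβ : ∀ i, β i = b i)
    (h : ∀ j < q, (f ^ b j) (u j) ∈ stableSpan f u j)
    (htop : stableSpan f u q = ⊤) (hdim : Module.finrank K V = ∑ i, β i) :
    ∃ B : Module.Basis ((i : Fin q) × Fin (β i)) K V,
      ∀ i a, B ⟨i, a⟩ = (f ^ (β i - 1 - a)) (u i) := by
  -- Exponents decrease along a block because `jordanBlock` has its ones on the superdiagonal: `f`
  -- must lower the position by one.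
  let v : ((i : Fin q) × Fin (β i)) → V := fun s => (f ^ (β s.1 - 1 - s.2)) (u s.1)
  have hspan : ⊤ ≤ Submodule.span K (Set.range v) := by
    rw [← htop]
    refine (stableSpan_le_span f u b q h).trans (Submodule.span_mono ?_)
    rintro _ ⟨i, hi, a, ha, rfl⟩
    have e := hβ ⟨i, hi⟩
    refine ⟨⟨⟨i, hi⟩, ⟨β ⟨i, hi⟩ - 1 - a, by simp only at e; omega⟩⟩, ?_⟩
    simp only [v]
    simp only at e
    rw [show β ⟨i, hi⟩ - 1 - (β ⟨i, hi⟩ - 1 - a) = a by omega]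
  refine ⟨basisOfTopLeSpanOfCardEqFinrank v hspan (by simp [hdim]), fun i a => ?_⟩
  rw [coe_basisOfTopLeSpanOfCardEqFinrank]

variable {f : Module.End K V} {u : ℕ → V} {q : ℕ} {b : ℕ → ℕ} {β : Fin q → ℕ}

theorem repr_flag_basis_eq_zero (hβ : ∀ i, β i = b i)
    (h : ∀ j < q, (f ^ b j) (u j) ∈ stableSpan f u j)
    (B : Module.Basis ((i : Fin q) × Fin (β i)) K V)
    (hB : ∀ i a, B ⟨i, a⟩ = (f ^ (β i - 1 - a)) (u i)) {i : Fin q} (a : Fin (β i)) {j : ℕ}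
    (hj : j ≤ i) {x : V} (hx : x ∈ stableSpan f u j) : B.repr x ⟨i, a⟩ = 0 := by
  have hx' := stableSpan_le_span f u b j (fun k hk => h k (by omega)) hx
  have : Submodule.span K {x | ∃ i < j, ∃ a < b i, x = (f ^ a) (u i)} ≤
      LinearMap.ker (B.coord ⟨i, a⟩) := by
    refine Submodule.span_le.2 ?_
    rintro _ ⟨k, hk, c, hc, rfl⟩
    have e := hβ ⟨k, by omega⟩
    simp only at e
    have : (f ^ c) (u k) = B ⟨⟨k, by omega⟩, ⟨β ⟨k, by omega⟩ - 1 - c, by omega⟩⟩ := by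
      rw [hB]
      simp only
      rw [show β ⟨k, by omega⟩ - 1 - (β ⟨k, by omega⟩ - 1 - c) = c by omega]
    rw [this]
    simp only [SetLike.mem_coe, LinearMap.mem_ker, Module.Basis.coord_apply,
      Module.Basis.repr_self]
    refine Finsupp.single_eq_of_ne ?_
    rintro heq
    have := congrArg (fun s => (s.1 : ℕ)) heq
    simp at this
    omega
  exact this hx'

theorem apply_flag_basis_succ (B : Module.Basis ((i : Fin q) × Fin (β i)) K V)
    (hB : ∀ i a, B ⟨i, a⟩ = (f ^ (β i - 1 - a)) (u i)) (i : Fin q) (a : Fin (β i))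
    (ha : (a : ℕ) ≠ 0) : f (B ⟨i, a⟩) = B ⟨i, ⟨a - 1, by omega⟩⟩ := by
  rw [hB, hB, ← Module.End.mul_apply, ← pow_succ']
  simp only
  rw [show β i - 1 - (a : ℕ) + 1 = β i - 1 - (a - 1) by omega]

theorem apply_flag_basis_zero (B : Module.Basis ((i : Fin q) × Fin (β i)) K V)
    (hB : ∀ i a, B ⟨i, a⟩ = (f ^ (β i - 1 - a)) (u i)) (i : Fin q) (a : Fin (β i))
    (ha : (a : ℕ) = 0) : f (B ⟨i, a⟩) = (f ^ β i) (u i) := by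
  rw [hB, ← Module.End.mul_apply, ← pow_succ', show β i - 1 - (a : ℕ) + 1 = β i by omega]

/-- In an adapted basis the matrix is block upper triangular, with Jordan blocks on the
diagonal; the blocks above the diagonal vanish in the columns of those `u j` which are killed by
`f ^ β j`. -/
theorem repr_apply_flag_basis (hβ : ∀ i, β i = b i)
    (h : ∀ j < q, (f ^ b j) (u j) ∈ stableSpan f u j)
    (B : Module.Basis ((i : Fin q) × Fin (β i)) K V)
    (hB : ∀ i a, B ⟨i, a⟩ = (f ^ (β i - 1 - a)) (u i)) (s t : (i : Fin q) × Fin (β i))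
    (hst : t.1 ≤ s.1 ∨ (f ^ β t.1) (u t.1) = 0) : B.repr (f (B t)) s =
      Matrix.blockDiagonal' (fun i => jordanBlock K (β i)) s t := by
  obtain ⟨i, a⟩ := s
  obtain ⟨j, c⟩ := t
  simp only at hst
  -- Only the first column of a block can differ from the Jordan matrix: there `f` gives `f ^ β j (u
  -- j)`, which lies in the span of the earlier blocks. On other columns `f` is a shift.
  by_cases hc : (c : ℕ) = 0
  · have h0 : B.repr ((f ^ β j) (u j)) ⟨i, a⟩ = 0 := by
      rcases hst with hst | hst
      · exact repr_flag_basis_eq_zero hβ h B hB a hst (by rw [hβ j]; exact h j j.2)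
      · rw [hst, map_zero, Finsupp.zero_apply]
    rw [apply_flag_basis_zero B hB j c hc, h0, Matrix.blockDiagonal'_apply]
    split_ifs with hij
    · obtain rfl : i = j := hij
      simp [jordanBlock, hc]
    · rfl
  · rw [apply_flag_basis_succ B hB j c hc, Module.Basis.repr_self,
      Matrix.blockDiagonal'_apply, Finsupp.single_apply]
    split_ifs with h1 h2 h2
    · obtain ⟨rfl, h1⟩ := Sigma.mk.inj_iff.1 h1
      obtain rfl := eq_of_heq h1
      simp only [jordanBlock, cast_eq, Matrix.of_apply]
      rw [if_pos (by omega)]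
    · obtain ⟨rfl, h1⟩ := Sigma.mk.inj_iff.1 h1
      exact absurd rfl h2
    · obtain rfl : i = j := h2
      simp only [jordanBlock, cast_eq, Matrix.of_apply]
      rw [if_neg]
      intro h3
      exact h1 (by rw [Sigma.mk.inj_iff]; exact ⟨rfl, heq_of_eq (Fin.ext (by simp; omega))⟩)
    · rfl

end FlagBasis

/-! ### Conjugation orbits and diagonal cocharacters -/

section Limits

variable {κ : Type*} [Field κ] {n : ℕ}

theorem conjOrbit_self_mem (x : Matrix (Fin n) (Fin n) κ) : x ∈ conjOrbit x := ⟨1, by simp⟩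

theorem conjOrbit_eq_of_mem {x y : Matrix (Fin n) (Fin n) κ} (h : y ∈ conjOrbit x) :
    conjOrbit y = conjOrbit x := by
  obtain ⟨g, rfl⟩ := h
  ext z
  constructor
  · rintro ⟨k, rfl⟩
    exact ⟨k * g, by simp only [mul_inv_rev, Units.val_mul, mul_assoc]⟩
  · rintro ⟨k, rfl⟩
    have hg : ∀ M : Matrix (Fin n) (Fin n) κ, ((g⁻¹ : GL (Fin n) κ) :
      Matrix (Fin n) (Fin n) κ) * ((g : Matrix (Fin n) (Fin n) κ) * M) = M := by
      intro M
      rw [← mul_assoc, show ((g⁻¹ : GL (Fin n) κ) : Matrix (Fin n) (Fin n) κ) * g = 1 from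
        g.inv_mul, one_mul]
    exact ⟨k * g⁻¹, by simp only [mul_inv_rev, inv_inv, Units.val_mul, mul_assoc, hg]⟩

theorem mem_conjOrbit_toMatrix (x : Matrix (Fin n) (Fin n) κ)
    (B : Module.Basis (Fin n) κ (Fin n → κ)) :
    x ∈ conjOrbit (LinearMap.toMatrix B B (Matrix.toLin' x)) := by
  refine ⟨⟨(Pi.basisFun κ (Fin n)).toMatrix B, B.toMatrix (Pi.basisFun κ (Fin n)),
    Module.Basis.toMatrix_mul_toMatrix_flip _ _, Module.Basis.toMatrix_mul_toMatrix_flip _ _⟩, ?_⟩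
  have := basis_toMatrix_mul_linearMap_toMatrix_mul_basis_toMatrix (Pi.basisFun κ (Fin n)) B
    (Pi.basisFun κ (Fin n)) B (Matrix.toLin' x)
  rw [LinearMap.toMatrix_eq_toMatrix', LinearMap.toMatrix'_toLin'] at this
  exact this

/-- The diagonal cocharacter with weights `d`. -/
noncomputable def diagonalCocharacter (κ : Type*) [Field κ] {n : ℕ} (d : Fin n → ℕ) :
    Cocharacter κ n where
  toHom :=
    { toFun := fun a => ⟨Matrix.diagonal fun i => (a : κ) ^ d i,
        Matrix.diagonal fun i => ((a⁻¹ : κˣ) : κ) ^ d i,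
        by simp [Matrix.diagonal_mul_diagonal],
        by simp [Matrix.diagonal_mul_diagonal]⟩
      map_one' := by ext; simp
      map_mul' := fun a b => by
        ext i j
        rcases eq_or_ne i j with rfl | h
        · simp [mul_pow]
        · simp [Matrix.diagonal_apply_ne _ h] }
  regular := by
    refine ⟨Matrix.diagonal fun i => LaurentPolynomial.T (d i), fun a i j => ?_⟩
    rcases eq_or_ne i j with rfl | h
    · simp
    · simp [Matrix.diagonal_apply_ne _ h]

/-- Conjugation multiplies the entry `(s, t)` by `a ^ (d s - d t)`. Entries of negative weight
vanish by the two hypotheses, so truncated subtraction is harmless; weight zero survives, and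
positive weight tends to zero. -/
theorem diagonalCocharacter_hasLimit (d : Fin n → ℕ) {x y : Matrix (Fin n) (Fin n) κ}
    (h₁ : ∀ s t, d s ≤ d t → x s t = y s t) (h₂ : ∀ s t, d s ≠ d t → y s t = 0) :
    (diagonalCocharacter κ d).HasLimit x y := by
  refine ⟨Matrix.of fun s t => Polynomial.C (x s t) * Polynomial.X ^ (d s - d t), fun a => ?_, ?_⟩
  · have e1 : ((diagonalCocharacter κ d).toHom a : Matrix (Fin n) (Fin n) κ) =
      Matrix.diagonal fun i => (a : κ) ^ d i := rfl
    have e2 : (((diagonalCocharacter κ d).toHom a)⁻¹ : GL (Fin n) κ).val =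
      Matrix.diagonal fun i => ((a⁻¹ : κˣ) : κ) ^ d i := rfl
    rw [e1, e2]
    ext s t
    rw [Matrix.mul_diagonal, Matrix.diagonal_mul]
    simp only [Matrix.map_apply, Matrix.of_apply, Polynomial.eval_mul, Polynomial.eval_C,
      Polynomial.eval_pow, Polynomial.eval_X]
    rcases Nat.lt_or_ge (d s) (d t) with h | h
    · rw [h₁ s t h.le, h₂ s t h.ne]; simp
    · obtain ⟨c, hc⟩ := Nat.exists_eq_add_of_le h
      rw [hc, Nat.add_sub_cancel_left, pow_add]
      have : (a : κ) ^ d t * ((a⁻¹ : κˣ) : κ) ^ d t = 1 := by rw [← mul_pow]; simp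
      linear_combination (a : κ) ^ c * x s t * this
  · ext s t
    simp only [Matrix.map_apply, Matrix.of_apply, Polynomial.eval_mul, Polynomial.eval_C,
      Polynomial.eval_pow, Polynomial.eval_X]
    rcases lt_trichotomy (d s) (d t) with h | h | h
    · rw [h₁ s t h.le, h₂ s t h.ne, zero_mul]
    · rw [h₁ s t h.le, h, Nat.sub_self, pow_zero, mul_one]
    · rw [h₂ s t h.ne', zero_pow (by omega), mul_zero]

end Limits

/-! ### Partitions, ranks of powers of Jordan matrices, and dominance -/

section Jordan

open scoped Matrix

variable (κ : Type*) [Field κ] {n : ℕ}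

/-- The `i`-th part of a partition, in decreasing order and extended by zeros. -/
def part (π : n.Partition) (i : ℕ) : ℕ := (sortedParts π).getD i 0

theorem get_sortedParts (π : n.Partition) (i : Fin (sortedParts π).length) :
    (sortedParts π).get i = part π i := by
  simp [part]

theorem part_of_length_le (π : n.Partition) {i : ℕ} (h : (sortedParts π).length ≤ i) :
    part π i = 0 := by
  simp [part, h]

theorem part_antitone (π : n.Partition) : Antitone (part π) := by
  intro i j hij
  rcases Nat.lt_or_ge j (sortedParts π).length with h | h
  · have hs : (sortedParts π).Pairwise (· ≥ ·) := Multiset.pairwise_sort _ _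
    rw [part, part, List.getD_eq_getElem _ _ h, List.getD_eq_getElem _ _ (hij.trans_lt h)]
    rcases eq_or_lt_of_le hij with rfl | hij
    · exact le_rfl
    · exact List.pairwise_iff_getElem.1 hs i j _ _ hij
  · rw [part_of_length_le π h]; exact Nat.zero_le _

theorem sum_take_eq_sum_range_getD (l : List ℕ) (k : ℕ) :
    (l.take k).sum = ∑ i ∈ Finset.range k, l.getD i 0 := by
  induction l generalizing k with
  | nil => simp
  | cons a l ih =>
    cases k with
    | zero => simp
    | succ k => simp [Finset.sum_range_succ', ih, add_comm]

theorem dominates_iff (π₁ π₂ : n.Partition) : Dominates π₁ π₂ ↔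
    ∀ k, ∑ i ∈ Finset.range k, part π₂ i ≤ ∑ i ∈ Finset.range k, part π₁ i := by
  simp only [Dominates, sum_take_eq_sum_range_getD, part]

theorem sum_part_length (π : n.Partition) :
    ∑ i ∈ Finset.range (sortedParts π).length, part π i = n := by
  rw [Finset.sum_range]
  simp_rw [← get_sortedParts]
  exact sum_sortedParts π

theorem sum_part_le (π : n.Partition) (k : ℕ) : ∑ i ∈ Finset.range k, part π i ≤ n := by
  refine le_of_le_of_eq ?_ (sum_part_length π)
  refine (Finset.sum_subset_zero_on_sdiff (s₁ := Finset.range (min k (sortedParts π).length))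
    (Finset.range_mono (min_le_left _ _)) ?_ fun _ _ => rfl).symm.le.trans
    (Finset.sum_le_sum_of_subset (Finset.range_mono (min_le_right _ _)))
  intro i hi
  simp only [Finset.mem_sdiff, Finset.mem_range] at hi
  exact part_of_length_le π (by omega)

theorem jordanMatrix_apply (π : n.Partition) (s t) :
    jordanMatrix κ π (blockEquiv π s) (blockEquiv π t) =
      Matrix.blockDiagonal' (fun i => jordanBlock κ ((sortedParts π).get i)) s t := by
  simp [jordanMatrix]

theorem jordanMatrix_mulVec (π : n.Partition) (j : Fin (sortedParts π).length)
    (c : Fin ((sortedParts π).get j)) :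
    jordanMatrix κ π *ᵥ Pi.single (blockEquiv π ⟨j, c⟩) 1 =
      if (c : ℕ) = 0 then 0 else Pi.single (blockEquiv π ⟨j, ⟨c - 1, by omega⟩⟩) 1 := by
  ext s
  obtain ⟨⟨i, a⟩, rfl⟩ := (blockEquiv π).surjective s
  rw [Matrix.mulVec_single_one, Matrix.col_apply, jordanMatrix_apply,
    Matrix.blockDiagonal'_apply]
  split_ifs with h hc hc
  · obtain rfl : i = j := h
    simp [jordanBlock, hc]
  · obtain rfl : i = j := h
    rw [Pi.single_apply]
    simp only [jordanBlock, cast_eq, Matrix.of_apply, EmbeddingLike.apply_eq_iff_eq,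
      Sigma.mk.inj_iff, heq_eq_eq, true_and, Fin.ext_iff]
    congr 1
    apply propext
    omega
  · rfl
  · rw [Pi.single_apply, if_neg]
    intro h'
    exact h (Sigma.mk.inj_iff.1 ((blockEquiv π).injective h')).1

theorem jordanMatrix_pow_mulVec (π : n.Partition) (j : Fin (sortedParts π).length)
    (c : Fin ((sortedParts π).get j)) (k : ℕ) :
    jordanMatrix κ π ^ k *ᵥ Pi.single (blockEquiv π ⟨j, c⟩) 1 =
      if (c : ℕ) < k then 0 else Pi.single (blockEquiv π ⟨j, ⟨c - k, by omega⟩⟩) 1 := by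
  induction k with
  | zero => rw [pow_zero, Matrix.one_mulVec]; simp
  | succ k ih =>
    rw [pow_succ', ← Matrix.mulVec_mulVec, ih]
    rcases lt_trichotomy (c : ℕ) k with h | h | h
    · rw [if_pos h, if_pos (by omega), Matrix.mulVec_zero]
    · rw [if_neg (by omega), if_pos (by omega), jordanMatrix_mulVec, if_pos (by simp; omega)]
    · rw [if_neg (by omega), if_neg (by omega), jordanMatrix_mulVec, if_neg (by simp; omega)]
      simp only [Nat.sub_sub]

theorem part_pos (π : n.Partition) {i : ℕ} (h : i < (sortedParts π).length) : 0 < part π i := by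
  rw [part, List.getD_eq_getElem _ _ h]
  refine π.parts_pos ?_
  rw [← Multiset.mem_sort (r := (· ≥ ·))]
  exact List.getElem_mem _

/-- The Jordan matrix is generated by one vector for each block. -/
theorem exists_jordan_generators (π : n.Partition) : ∃ w : ℕ → (Fin n → κ),
    (∀ i, (Matrix.toLin' (jordanMatrix κ π) ^ part π i) (w i) = 0) ∧
      stableSpan (Matrix.toLin' (jordanMatrix κ π)) w (sortedParts π).length = ⊤ := by
  classical
  have hpos : ∀ i : Fin (sortedParts π).length, 0 < (sortedParts π).get i := fun i => by
    rw [get_sortedParts]; exact part_pos π i.2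
  let w : ℕ → (Fin n → κ) := fun i => if h : i < (sortedParts π).length then
    Pi.single (blockEquiv π ⟨⟨i, h⟩, ⟨(sortedParts π).get ⟨i, h⟩ - 1,
      Nat.sub_lt (hpos _) one_pos⟩⟩) 1 else 0
  have hw : ∀ i : Fin (sortedParts π).length, w i = Pi.single (blockEquiv π ⟨i,
      ⟨(sortedParts π).get i - 1, Nat.sub_lt (hpos _) one_pos⟩⟩) 1 := fun i => by
    simp only [w, i.2, dif_pos]
  refine ⟨w, fun i => ?_, ?_⟩
  · rcases Nat.lt_or_ge i (sortedParts π).length with h | h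
    · rw [hw ⟨i, h⟩, ← Matrix.toLin'_pow, Matrix.toLin'_apply, jordanMatrix_pow_mulVec,
        ← get_sortedParts π ⟨i, h⟩, if_pos]
      exact Nat.sub_lt (hpos _) one_pos
    · simp [w, Nat.not_lt.2 h]
  · rw [eq_top_iff, ← (Pi.basisFun κ (Fin n)).span_eq, Submodule.span_le]
    rintro _ ⟨s, rfl⟩
    obtain ⟨⟨i, a⟩, rfl⟩ := (blockEquiv π).surjective s
    have := pow_mem_stableSpan (Matrix.toLin' (jordanMatrix κ π)) w i.2
      ((sortedParts π).get i - 1 - a)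
    rw [hw, ← Matrix.toLin'_pow, Matrix.toLin'_apply, jordanMatrix_pow_mulVec, if_neg
      (by simp only; omega)] at this
    have e : (⟨(sortedParts π).get i - 1 - ((sortedParts π).get i - 1 - a), by omega⟩ :
      Fin ((sortedParts π).get i)) = a := Fin.ext (by simp only; omega)
    simp only [e] at this
    simpa using this

theorem sum_part_sub_length (π : n.Partition) (k : ℕ) :
    ∑ i, ((sortedParts π).get i - k) =
      ∑ i ∈ Finset.range (sortedParts π).length, (part π i - k) := by
  rw [Finset.sum_range]
  simp_rw [← get_sortedParts]

/-- The nonzero columns of the `k`-th power are the standard basis vectors at the first `part π i -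
k` positions of each block. -/
theorem rank_jordanMatrix_pow (π : n.Partition) (k : ℕ) :
    (jordanMatrix κ π ^ k).rank =
      ∑ i ∈ Finset.range (sortedParts π).length, (part π i - k) := by
  rw [← sum_part_sub_length, Matrix.rank_eq_finrank_span_cols]
  let v : ((i : Fin (sortedParts π).length) × Fin ((sortedParts π).get i - k)) → (Fin n → κ) :=
    fun s => Pi.single (blockEquiv π ⟨s.1, ⟨s.2, by omega⟩⟩) 1
  have hv : LinearIndependent κ v := by
    have := (Pi.basisFun κ (Fin n)).linearIndependent.comp
      (fun s : ((i : Fin (sortedParts π).length) × Fin ((sortedParts π).get i - k)) =>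
        blockEquiv π ⟨s.1, ⟨s.2, by omega⟩⟩) (by
      rintro ⟨i, a⟩ ⟨j, c⟩ h
      obtain ⟨h1, h2⟩ := Sigma.mk.inj_iff.1 ((blockEquiv π).injective h)
      simp only at h1
      subst h1
      simpa [Fin.ext_iff] using h2)
    convert this using 1
    ext s : 1
    simp [v]
  have hspan : Submodule.span κ (Set.range (jordanMatrix κ π ^ k).col) =
      Submodule.span κ (Set.range v) := by
    have hcol : ∀ t, (jordanMatrix κ π ^ k).col t = jordanMatrix κ π ^ k *ᵥ Pi.single t 1 :=
      fun t => (Matrix.mulVec_single_one _ _).symm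
    apply le_antisymm <;> rw [Submodule.span_le]
    · rintro _ ⟨t, rfl⟩
      obtain ⟨⟨j, c⟩, rfl⟩ := (blockEquiv π).surjective t
      rw [hcol, jordanMatrix_pow_mulVec]
      split_ifs with h
      · exact zero_mem _
      · exact Submodule.subset_span ⟨⟨j, ⟨c - k, by omega⟩⟩, rfl⟩
    · rintro _ ⟨⟨j, c⟩, rfl⟩
      refine Submodule.subset_span ⟨blockEquiv π ⟨j, ⟨c + k, by omega⟩⟩, ?_⟩
      rw [hcol, jordanMatrix_pow_mulVec, if_neg (by simp)]
      simp [v]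
  rw [hspan, finrank_span_eq_card hv]
  simp

theorem sum_part_sub_eq (π : n.Partition) (k : ℕ) {N : ℕ} (h : (sortedParts π).length ≤ N) :
    ∑ i ∈ Finset.range (sortedParts π).length, (part π i - k) =
      ∑ i ∈ Finset.range N, (part π i - k) := by
  refine Finset.sum_subset (Finset.range_mono h) fun i _ hi => ?_
  rw [part_of_length_le π (by simpa using hi), Nat.zero_sub]

/-- To compare sums of `m` parts, use the power `c = part π₁ m`. The first `m` parts of `π₁` are at
least `c` and the others at most `c`, so the rank for `π₁` is exactly its partial sum minus `m * c`.
For `π₂` the rank is at least the partial sum minus `m * c`. -/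
theorem dominates_of_rank_le {π₁ π₂ : n.Partition}
    (h : ∀ k, (jordanMatrix κ π₂ ^ k).rank ≤ (jordanMatrix κ π₁ ^ k).rank) :
    Dominates π₁ π₂ := by
  rw [dominates_iff]
  intro m
  have hm := h (part π₁ m)
  set c := part π₁ m with hc
  set N := (sortedParts π₁).length + (sortedParts π₂).length + m with hN
  rw [rank_jordanMatrix_pow, rank_jordanMatrix_pow, sum_part_sub_eq π₁ c (N := N) (by omega),
    sum_part_sub_eq π₂ c (N := N) (by omega)] at hm
  have e1 : ∑ i ∈ Finset.range N, (part π₁ i - c) = ∑ i ∈ Finset.range m, (part π₁ i - c) := by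
    refine (Finset.sum_subset (Finset.range_mono (by omega)) fun i _ hi => ?_).symm
    have := part_antitone π₁ (show m ≤ i by simpa using hi)
    omega
  have e2 : ∑ i ∈ Finset.range m, (part π₂ i - c) ≤ ∑ i ∈ Finset.range N, (part π₂ i - c) :=
    Finset.sum_le_sum_of_subset (Finset.range_mono (by omega))
  have e3 : ∑ i ∈ Finset.range m, (part π₁ i - c) + m * c = ∑ i ∈ Finset.range m, part π₁ i := by
    rw [show m * c = ∑ i ∈ Finset.range m, c by simp, ← Finset.sum_add_distrib]
    refine Finset.sum_congr rfl fun i hi => Nat.sub_add_cancel ?_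
    exact part_antitone π₁ (Finset.mem_range.1 hi).le
  have e4 : ∑ i ∈ Finset.range m, part π₂ i ≤ ∑ i ∈ Finset.range m, (part π₂ i - c) + m * c := by
    rw [show m * c = ∑ i ∈ Finset.range m, c by simp, ← Finset.sum_add_distrib]
    exact Finset.sum_le_sum fun i _ => by omega
  omega

theorem part_injective : Function.Injective (part : n.Partition → ℕ → ℕ) := by
  intro π₁ π₂ h
  have hlen : ∀ π₁ π₂ : n.Partition, part π₁ = part π₂ →
      (sortedParts π₁).length ≤ (sortedParts π₂).length := by
    intro π₁ π₂ h
    by_contra! hlt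
    have := part_pos π₁ hlt
    rw [h, part_of_length_le π₂ le_rfl] at this
    exact lt_irrefl _ this
  have hs : sortedParts π₁ = sortedParts π₂ := by
    refine List.ext_getElem (le_antisymm (hlen _ _ h) (hlen _ _ h.symm)) fun i h1 h2 => ?_
    have := congrFun h i
    rwa [part, part, List.getD_eq_getElem _ _ h1, List.getD_eq_getElem _ _ h2] at this
  ext1
  have := congrArg (fun l : List ℕ => (l : Multiset ℕ)) hs
  simpa [sortedParts] using this

theorem Dominates.antisymm {π₁ π₂ : n.Partition} (h₁ : Dominates π₁ π₂) (h₂ : Dominates π₂ π₁) :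
    π₁ = π₂ := by
  rw [dominates_iff] at h₁ h₂
  refine part_injective (funext fun i => ?_)
  have e := fun k => le_antisymm (h₁ k) (h₂ k)
  have := e (i + 1)
  rw [Finset.sum_range_succ, Finset.sum_range_succ, e i] at this
  omega

end Jordan

/-! ### Jordan form of nilpotent matrices -/

section Classification

open Polynomial

/-- With `X` acting as `f`, the space is an `X`-power torsion module over `K[X]`, hence a direct sum
of modules `K[X] / (X ^ k i)`; `v i` corresponds to the class of `1`. Some `k i` may be zero. -/
theorem exists_cyclic_decomposition {K : Type*} [Field K] {n : ℕ} (f : Module.End K (Fin n → K))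
    (hf : IsNilpotent f) : ∃ (d : ℕ) (k : Fin d → ℕ) (v : Fin d → (Fin n → K)),
      (∀ i, (f ^ k i) (v i) = 0) ∧ ∑ i, k i = n ∧
      ∀ W : Submodule K (Fin n → K), (∀ x ∈ W, f x ∈ W) → (∀ i, v i ∈ W) → W = ⊤ := by
  obtain ⟨N, hN⟩ := hf
  have htors : Module.IsTorsion' (Module.AEval' f) (Submonoid.powers (X : K[X])) := by
    intro m
    refine ⟨⟨X ^ N, N, rfl⟩, ?_⟩
    obtain ⟨x, rfl⟩ := (Module.AEval'.of f).surjective m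
    change (X ^ N : K[X]) • Module.AEval'.of f x = 0
    rw [Module.AEval'.X_pow_smul_of, hN, zero_smul, map_zero]
  obtain ⟨d, k, ⟨φ⟩⟩ := Module.torsion_by_prime_power_decomposition (irreducible_X (R := K)) htors
  let v : Fin d → (Fin n → K) := fun i => (Module.AEval'.of f).symm
    (φ.symm (DirectSum.lof K[X] (Fin d) (fun i => K[X] ⧸ K[X] ∙ (X ^ k i : K[X])) i
      (Submodule.Quotient.mk 1)))
  have hv : ∀ i (p : K[X]), (aeval f p) (v i) = (Module.AEval'.of f).symm
    (φ.symm (DirectSum.lof K[X] (Fin d) (fun i => K[X] ⧸ K[X] ∙ (X ^ k i : K[X])) i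
      (Submodule.Quotient.mk p))) := by
    intro i p
    have e : (Submodule.Quotient.mk p : K[X] ⧸ K[X] ∙ (X ^ k i : K[X])) =
      p • Submodule.Quotient.mk 1 := by
      rw [← Submodule.Quotient.mk_smul, smul_eq_mul, mul_one]
    rw [e, map_smul, map_smul]
    exact (Module.AEval.of_symm_smul f p _).symm
  refine ⟨d, k, v, fun i => ?_, ?_, fun W hW hvW => ?_⟩
  · have := hv i (X ^ k i)
    rw [map_pow, aeval_X] at this
    rw [this, (Submodule.Quotient.mk_eq_zero _).2 (Submodule.mem_span_singleton_self _), map_zero,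
      map_zero, map_zero]
  · have hfin : ∀ i, Module.Finite K (K[X] ⧸ K[X] ∙ (X ^ k i : K[X])) := fun i =>
      (monic_X_pow (k i)).finite_quotient
    have e1 := ((Module.AEval'.of f).trans (φ.restrictScalars K)).finrank_eq
    rw [Module.finrank_fin_fun, Module.finrank_directSum] at e1
    rw [e1]
    refine Finset.sum_congr rfl fun i _ => ?_
    exact (natDegree_X_pow (R := K) (k i)).symm.trans finrank_quotient_span_eq_natDegree.symm
  · rw [eq_top_iff]
    rintro x -
    obtain ⟨z, rfl⟩ := ((Module.AEval'.of f).toEquiv.trans φ.toEquiv).symm.surjective x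
    change (Module.AEval'.of f).symm (φ.symm z) ∈ W
    induction z using DirectSum.induction_on with
    | zero => rw [map_zero, map_zero]; exact zero_mem _
    | of i y =>
      obtain ⟨p, rfl⟩ := Submodule.Quotient.mk_surjective _ y
      have := hv i p
      change _ = (Module.AEval'.of f).symm (φ.symm (DirectSum.of _ i _)) at this
      rw [← this, aeval_eq_sum_range, LinearMap.sum_apply]
      refine sum_mem fun j _ => ?_
      rw [LinearMap.smul_apply]
      exact W.smul_mem _ (pow_mem_of_stable hW (hvW i) j)
    | add y z hy hz => rw [map_add, map_add]; exact add_mem hy hz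

variable {κ : Type*} [Field κ] {n : ℕ}

/-- The alternative serves two uses: `t.1 ≤ s.1` controls the blocks on and below the diagonal for
the limit, and exact vanishing gives the Jordan form itself. -/
theorem exists_adapted_matrix (π : n.Partition) (x : Matrix (Fin n) (Fin n) κ)
    (u : ℕ → (Fin n → κ))
    (h : ∀ j < (sortedParts π).length,
      (Matrix.toLin' x ^ part π j) (u j) ∈ stableSpan (Matrix.toLin' x) u j)
    (htop : stableSpan (Matrix.toLin' x) u (sortedParts π).length = ⊤) :
    ∃ M : Matrix (Fin n) (Fin n) κ, x ∈ conjOrbit M ∧ ∀ s t,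
      (t.1 ≤ s.1 ∨ (Matrix.toLin' x ^ part π t.1) (u t.1) = 0) →
        M (blockEquiv π s) (blockEquiv π t) =
          jordanMatrix κ π (blockEquiv π s) (blockEquiv π t) := by
  obtain ⟨B, hB⟩ := exists_flag_basis (Matrix.toLin' x) u (sortedParts π).length (part π)
    (fun i => (sortedParts π).get i) (get_sortedParts π) h htop
    (by rw [Module.finrank_fin_fun, sum_sortedParts])
  refine ⟨_, mem_conjOrbit_toMatrix x (B.reindex (blockEquiv π)), fun s t hst => ?_⟩
  rw [jordanMatrix_apply, ← repr_apply_flag_basis (get_sortedParts π) h B hB s t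
    (by rw [get_sortedParts]; exact hst)]
  simp [LinearMap.toMatrix_apply]

theorem mem_conjOrbit_jordanMatrix (π : n.Partition) (x : Matrix (Fin n) (Fin n) κ)
    (w : ℕ → (Fin n → κ)) (h : ∀ i, (Matrix.toLin' x ^ part π i) (w i) = 0)
    (htop : stableSpan (Matrix.toLin' x) w (sortedParts π).length = ⊤) :
    x ∈ conjOrbit (jordanMatrix κ π) := by
  obtain ⟨M, hx, hM⟩ := exists_adapted_matrix π x w
    (fun j _ => by rw [h j]; exact zero_mem _) htop
  have : M = jordanMatrix κ π := by
    ext s t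
    obtain ⟨s, rfl⟩ := (blockEquiv π).surjective s
    obtain ⟨t, rfl⟩ := (blockEquiv π).surjective t
    exact hM s t (Or.inr (h _))
  rwa [this] at hx

/-- Nilpotent matrices have a Jordan form. -/
theorem exists_mem_conjOrbit_jordanMatrix (x : Matrix (Fin n) (Fin n) κ) (hx : IsNilpotent x) :
    ∃ π : n.Partition, x ∈ conjOrbit (jordanMatrix κ π) := by
  classical
  obtain ⟨d, k, v, hkv, hsum, hgen⟩ := exists_cyclic_decomposition (Matrix.toLin' x)
    (hx.map (Matrix.toLinAlgEquiv' (R := κ) (n := Fin n)))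
  -- Zero exponents are dropped since parts of a partition are positive; lengths are kept paired
  -- with their generators while sorting.
  let L : List (ℕ × (Fin n → κ)) := (List.ofFn fun i => (k i, v i)).filter fun p => p.1 ≠ 0
  let L' := L.insertionSort fun p q => q.1 ≤ p.1
  have hperm : L'.Perm L := List.perm_insertionSort _ _
  have hmem : ∀ p, p ∈ L' ↔ (∃ i, (k i, v i) = p) ∧ p.1 ≠ 0 := fun p => by
    rw [hperm.mem_iff]
    simp [L, List.mem_ofFn]
  have hsorted : (L'.map Prod.fst).Pairwise (· ≥ ·) := by
    rw [List.pairwise_map]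
    exact List.pairwise_insertionSort _ _
  have hfilter : ∀ l : List (ℕ × (Fin n → κ)),
      ((l.filter fun p => p.1 ≠ 0).map Prod.fst).sum = (l.map Prod.fst).sum := by
    intro l
    induction l with
    | nil => rfl
    | cons a l ih =>
      by_cases h : a.1 = 0
      · rw [List.filter_cons_of_neg (by simpa using h), ih]; simp [h]
      · rw [List.filter_cons_of_pos (by simpa using h)]; simp only [List.map_cons, List.sum_cons, ih]
  let π : n.Partition :=
    { parts := (L'.map Prod.fst : List ℕ)
      parts_pos := by
        intro i hi
        obtain ⟨p, hp, rfl⟩ := List.mem_map.1 (Multiset.mem_coe.1 hi)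
        exact Nat.pos_of_ne_zero ((hmem p).1 hp).2
      parts_sum := by
        rw [Multiset.sum_coe, (hperm.map Prod.fst).sum_eq, hfilter, List.map_ofFn,
          List.sum_ofFn]
        exact hsum }
  have hπ : sortedParts π = L'.map Prod.fst := by
    change Multiset.sort ((L'.map Prod.fst : List ℕ) : Multiset ℕ) (· ≥ ·) = _
    rw [Multiset.coe_sort]
    exact List.mergeSort_of_pairwise (by simpa using hsorted)
  have hlen : (sortedParts π).length = L'.length := by rw [hπ, List.length_map]
  refine ⟨π, mem_conjOrbit_jordanMatrix π x (fun i => (L'.map Prod.snd).getD i 0) (fun i => ?_)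
    (hgen _ (stableSpan_stable _ _ _) fun i => ?_)⟩
  · rcases Nat.lt_or_ge i L'.length with h | h
    · obtain ⟨⟨j, hj⟩, -⟩ := (hmem L'[i]).1 (List.getElem_mem h)
      have e1 : part π i = k j := by
        rw [part, hπ, List.getD_eq_getElem _ _ (by simpa using h), List.getElem_map, ← hj]
      have e2 : (L'.map Prod.snd).getD i 0 = v j := by
        rw [List.getD_eq_getElem _ _ (by simpa using h), List.getElem_map, ← hj]
      rw [e1, e2, hkv]
    · rw [List.getD_eq_default _ _ (by simpa using h), map_zero]
  -- A generator dropped for having exponent zero is the zero vector.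
  · by_cases h : k i = 0
    · have := hkv i
      rw [h, pow_zero, Module.End.one_apply] at this
      rw [this]
      exact zero_mem _
    · obtain ⟨j, hj, e⟩ := List.getElem_of_mem ((hmem (k i, v i)).2 ⟨⟨i, rfl⟩, h⟩)
      have := mem_stableSpan (Matrix.toLin' x) (fun i => (L'.map Prod.snd).getD i 0)
        (show j < (sortedParts π).length by rw [hlen]; exact hj)
      rwa [List.getD_eq_getElem _ _ (by simpa using hj), List.getElem_map, e] at this

end Classification

/-! ### Accessibility, closures and dominance -/

section Accessibility

variable {κ : Type*} [Field κ] {n : ℕ}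

theorem oneAccessible_of_dominates {π₁ π₂ : n.Partition} (h : Dominates π₁ π₂) :
    OneAccessible (orbitOf κ π₁) (orbitOf κ π₂) := by
  rw [dominates_iff] at h
  obtain ⟨w, hw, hwtop⟩ := exists_jordan_generators κ π₁
  set x := jordanMatrix κ π₁ with hx
  obtain ⟨u, hu, hwu⟩ := exists_flag (Matrix.toLin' x) (sortedParts π₂).length (part π₂) (part π₁)
    w (part_antitone π₂) (part_antitone π₁) hw (fun k _ => h k)
    (fun k => (sum_part_le π₁ k).trans_eq (sum_part_length π₂).symm)
  have htop : stableSpan (Matrix.toLin' x) u (sortedParts π₂).length = ⊤ := by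
    rw [eq_top_iff, ← hwtop]
    exact stableSpan_le (stableSpan_stable _ _ _) fun i _ => hwu i
  obtain ⟨M, hxM, hM⟩ := exists_adapted_matrix π₂ x u hu htop
  -- The weight depends only on the block and strictly decreases with its index, so the entries
  -- above the diagonal blocks have positive weight.
  refine ⟨M, ?_, diagonalCocharacter κ fun s =>
    (sortedParts π₂).length - ((blockEquiv π₂).symm s).1, jordanMatrix κ π₂,
    conjOrbit_self_mem _, diagonalCocharacter_hasLimit _ ?_ ?_⟩
  · change M ∈ conjOrbit x
    rw [conjOrbit_eq_of_mem hxM]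
    exact conjOrbit_self_mem M
  · intro s t hst
    obtain ⟨s, rfl⟩ := (blockEquiv π₂).surjective s
    obtain ⟨t, rfl⟩ := (blockEquiv π₂).surjective t
    simp only [Equiv.symm_apply_apply] at hst
    exact hM s t (Or.inl (Fin.le_def.2 (by omega)))
  · intro s t hst
    obtain ⟨s, rfl⟩ := (blockEquiv π₂).surjective s
    obtain ⟨t, rfl⟩ := (blockEquiv π₂).surjective t
    simp only [Equiv.symm_apply_apply] at hst
    rw [jordanMatrix_apply, Matrix.blockDiagonal'_apply, dif_neg]
    intro e
    exact hst (by rw [e])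

theorem subset_zariskiClosure (S : Set (Matrix (Fin n) (Fin n) κ)) : S ⊆ zariskiClosure S :=
  fun _ hx _ hp => hp _ hx

/-- A limit along a cocharacter lies in the closure of the orbit. -/
theorem Cocharacter.HasLimit.mem_zariskiClosure [Infinite κ] {lam : Cocharacter κ n}
    {x y : Matrix (Fin n) (Fin n) κ} (h : lam.HasLimit x y) :
    y ∈ zariskiClosure (conjOrbit x) := by
  obtain ⟨P, hP, rfl⟩ := h
  intro p hp
  set r : κ[X] := MvPolynomial.aeval (fun ij : Fin n × Fin n => P ij.1 ij.2) p with hr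
  have hev : ∀ c : κ, r.eval c =
      MvPolynomial.eval (fun ij => P.map (Polynomial.eval c) ij.1 ij.2) p := by
    intro c
    rw [hr, MvPolynomial.aeval_def, ← Polynomial.coe_evalRingHom, MvPolynomial.hom_eval₂,
      MvPolynomial.eval, MvPolynomial.coe_eval₂Hom]
    congr 1
    ext
    simp
  -- The pullback `r` of `p` to the affine line vanishes at all `c ≠ 0`, where the point lies in the
  -- orbit; as `κ` is infinite it also vanishes at `0`.
  have hr0 : r = 0 := by
    refine Polynomial.eq_zero_of_infinite_isRoot r
      ((Set.finite_singleton (0 : κ)).infinite_compl.mono fun c hc => ?_)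
    change r.eval c = 0
    rw [hev]
    refine hp _ ⟨lam.toHom (Units.mk0 c hc), ?_⟩
    exact hP (Units.mk0 c hc)
  rw [← hev, hr0, Polynomial.eval_zero]

/-- The rank of a power is lower semicontinuous. -/
theorem rank_pow_le_of_mem_zariskiClosure {S : Set (Matrix (Fin n) (Fin n) κ)} {k r : ℕ}
    (hS : ∀ z ∈ S, (z ^ k).rank ≤ r) {y : Matrix (Fin n) (Fin n) κ} (hy : y ∈ zariskiClosure S) :
    (y ^ k).rank ≤ r := by
  by_contra! hlt
  -- `A` and `B` cut an identity block of full rank size out of `y ^ k`. The polynomial `det (A * z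
  -- ^ k * B)` in the entries of `z` then equals `1` at `y`, but vanishes on `S`, where the rank is
  -- too small.
  obtain ⟨A, B, hAB⟩ : ∃ (A : Matrix (Fin (y ^ k).rank) (Fin n) κ)
      (B : Matrix (Fin n) (Fin (y ^ k).rank) κ), A * y ^ k * B = 1 := by
    set g := Matrix.toLin' (y ^ k) with hg
    have hrank : Module.finrank κ (LinearMap.range g) = (y ^ k).rank := rfl
    let e := LinearEquiv.ofFinrankEq (Fin (y ^ k).rank → κ) (LinearMap.range g)
      (by rw [Module.finrank_fin_fun, hrank])
    obtain ⟨i, hi⟩ := LinearMap.exists_rightInverse_of_surjective g.rangeRestrict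
      (LinearMap.range_rangeRestrict g)
    obtain ⟨a, ha⟩ := LinearMap.exists_leftInverse_of_injective (LinearMap.range g).subtype
      (Submodule.ker_subtype _)
    refine ⟨LinearMap.toMatrix' (e.symm.toLinearMap ∘ₗ a), LinearMap.toMatrix' (i ∘ₗ e.toLinearMap),
      ?_⟩
    apply (Matrix.toLin' (R := κ)).injective
    rw [Matrix.toLin'_mul, Matrix.toLin'_mul, Matrix.toLin'_toMatrix', Matrix.toLin'_toMatrix',
      Matrix.toLin'_one, ← hg]
    ext1 j
    ext1
    have h1 : ∀ z, g (i z) = z := fun z => congrArg Subtype.val (LinearMap.congr_fun hi z)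
    have h2 : ∀ z : LinearMap.range g, a z = z := fun z => LinearMap.congr_fun ha z
    simp [h1, h2]
  let G : Matrix (Fin n) (Fin n) (MvPolynomial (Fin n × Fin n) κ) :=
    Matrix.of fun i j => MvPolynomial.X (i, j)
  let A' : Matrix (Fin (y ^ k).rank) (Fin n) (MvPolynomial (Fin n × Fin n) κ) :=
    A.map MvPolynomial.C
  let B' : Matrix (Fin n) (Fin (y ^ k).rank) (MvPolynomial (Fin n × Fin n) κ) :=
    B.map MvPolynomial.C
  let p := (A' * G ^ k * B').det
  have hp : ∀ z : Matrix (Fin n) (Fin n) κ,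
      MvPolynomial.eval (fun ij => z ij.1 ij.2) p = (A * z ^ k * B).det := by
    intro z
    have hG : G.map (MvPolynomial.eval fun ij : Fin n × Fin n => z ij.1 ij.2) = z := by
      ext i j; simp [G]
    have hC : ∀ {a b : Type} (M : Matrix a b κ), (M.map MvPolynomial.C).map
        (MvPolynomial.eval fun ij : Fin n × Fin n => z ij.1 ij.2) = M := by
      intro a b M; ext i j; simp
    rw [RingHom.map_det, RingHom.mapMatrix_apply, Matrix.map_mul, Matrix.map_mul, hC, hC,
      Matrix.map_pow, hG]
  have h0 := hy p fun z hz => by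
    rw [hp]
    by_contra hne
    have h1 := Matrix.rank_of_isUnit (A * z ^ k * B)
      ((Matrix.isUnit_iff_isUnit_det _).2 (isUnit_iff_ne_zero.2 hne))
    have h2 := (Matrix.rank_mul_le_left (A * z ^ k) B).trans (Matrix.rank_mul_le_right A (z ^ k))
    rw [h1, Fintype.card_fin] at h2
    exact absurd (h2.trans (hS z hz)) (not_le.2 hlt)
  rw [hp, hAB, Matrix.det_one] at h0
  exact one_ne_zero h0

theorem rank_pow_of_mem_conjOrbit {x y : Matrix (Fin n) (Fin n) κ} (h : y ∈ conjOrbit x) (k : ℕ) :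
    (y ^ k).rank = (x ^ k).rank := by
  obtain ⟨g, rfl⟩ := h
  rw [Units.conj_pow]
  have hg := (Matrix.isUnit_iff_isUnit_det _).1 g.isUnit
  have hg' := (Matrix.isUnit_iff_isUnit_det _).1 (g⁻¹).isUnit
  rw [Matrix.rank_mul_eq_left_of_isUnit_det _ _ hg', Matrix.rank_mul_eq_right_of_isUnit_det _ _ hg]

theorem jordanMatrix_mem_orbitOf (π : n.Partition) :
    jordanMatrix κ π ∈ (orbitOf κ π).1 := conjOrbit_self_mem _

theorem dominates_of_closureLE {π₁ π₂ : n.Partition}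
    (h : ClosureLE (orbitOf κ π₂) (orbitOf κ π₁)) : Dominates π₁ π₂ :=
  dominates_of_rank_le κ fun k => rank_pow_le_of_mem_zariskiClosure
    (fun _ hz => (rank_pow_of_mem_conjOrbit hz k).le)
    (h (subset_zariskiClosure _ (jordanMatrix_mem_orbitOf π₂)))

theorem zariskiClosure_subset_of_subset {S T : Set (Matrix (Fin n) (Fin n) κ)}
    (h : S ⊆ zariskiClosure T) : zariskiClosure S ⊆ zariskiClosure T :=
  fun _ hx p hp => hx p fun _ hy => h hy p hp

theorem OneAccessible.closureLE [Infinite κ] {O₁ O₂ : NilpotentOrbit κ n}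
    (h : OneAccessible O₁ O₂) : ClosureLE O₂ O₁ := by
  obtain ⟨_, x₁, h₁, rfl⟩ := O₁
  obtain ⟨_, x₂, h₂, rfl⟩ := O₂
  obtain ⟨x, hx, lam, y, hy, hlim⟩ := h
  refine zariskiClosure_subset_of_subset ?_
  change conjOrbit x₂ ⊆ zariskiClosure (conjOrbit x₁)
  rw [← conjOrbit_eq_of_mem hy, ← conjOrbit_eq_of_mem hx]
  rintro _ ⟨g, rfl⟩
  have := (hlim.conj g).mem_zariskiClosure
  rwa [conjOrbit_eq_of_mem ⟨g, rfl⟩] at this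

theorem Accessible.closureLE [Infinite κ] {O₁ O₂ : NilpotentOrbit κ n}
    (h : Accessible O₁ O₂) : ClosureLE O₂ O₁ := by
  induction h with
  | single h => exact h.closureLE
  | tail _ h ih => exact Set.Subset.trans h.closureLE ih

theorem exists_eq_orbitOf (O : NilpotentOrbit κ n) : ∃ π : n.Partition, orbitOf κ π = O := by
  obtain ⟨_, x, hx, rfl⟩ := O
  obtain ⟨π, hπ⟩ := exists_mem_conjOrbit_jordanMatrix x hx
  exact ⟨π, Subtype.ext (conjOrbit_eq_of_mem hπ).symm⟩

theorem ClosureLE.oneAccessible {O₁ O₂ : NilpotentOrbit κ n} (h : ClosureLE O₂ O₁) :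
    OneAccessible O₁ O₂ := by
  obtain ⟨π₁, rfl⟩ := exists_eq_orbitOf O₁
  obtain ⟨π₂, rfl⟩ := exists_eq_orbitOf O₂
  exact oneAccessible_of_dominates (dominates_of_closureLE h)

theorem accessible_iff_closureLE [Infinite κ] {O₁ O₂ : NilpotentOrbit κ n} :
    Accessible O₁ O₂ ↔ ClosureLE O₂ O₁ :=
  ⟨Accessible.closureLE, fun h => .single h.oneAccessible⟩

theorem ClosureLE.antisymm {O₁ O₂ : NilpotentOrbit κ n} (h₁ : ClosureLE O₂ O₁)
    (h₂ : ClosureLE O₁ O₂) : O₁ = O₂ := by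
  obtain ⟨π₁, rfl⟩ := exists_eq_orbitOf O₁
  obtain ⟨π₂, rfl⟩ := exists_eq_orbitOf O₂
  rw [(dominates_of_closureLE h₁).antisymm (dominates_of_closureLE h₂)]

theorem orbitOf_bijective : Function.Bijective fun π : n.Partition => orbitOf κ π := by
  refine ⟨fun π₁ π₂ h => ?_, exists_eq_orbitOf⟩
  simp only at h
  exact (dominates_of_closureLE (κ := κ) (by rw [h]; exact Set.Subset.rfl)).antisymm
    (dominates_of_closureLE (κ := κ) (by rw [h]; exact Set.Subset.rfl))

end Accessibility

end GLAccess

theorem mainTheorem1 (κ : Type*) [Field κ] [IsAlgClosed κ] (n : ℕ) :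
    -- if `π₁` dominates `π₂`, then `𝒪(π₂)` is `1`-accessible from `𝒪(π₁)`
    (∀ π₁ π₂ : n.Partition, GLAccess.Dominates π₁ π₂ →
      GLAccess.OneAccessible (GLAccess.orbitOf κ π₁) (GLAccess.orbitOf κ π₂)) ∧
    -- accessibility and `1`-accessibility coincide
    (∀ O₁ O₂ : GLAccess.NilpotentOrbit κ n,
      GLAccess.Accessible O₁ O₂ ↔ GLAccess.OneAccessible O₁ O₂) ∧
    -- accessibility is a partial order on the nilpotent orbits
    ((∀ O : GLAccess.NilpotentOrbit κ n, GLAccess.Accessible O O) ∧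
      (∀ O₁ O₂ O₃ : GLAccess.NilpotentOrbit κ n,
        GLAccess.Accessible O₁ O₂ → GLAccess.Accessible O₂ O₃ → GLAccess.Accessible O₁ O₃) ∧
      (∀ O₁ O₂ : GLAccess.NilpotentOrbit κ n,
        GLAccess.Accessible O₁ O₂ → GLAccess.Accessible O₂ O₁ → O₁ = O₂)) ∧
    -- it is the same as the dominance order, defined on orbits by inclusion of Zariski closures
    (∀ O₁ O₂ : GLAccess.NilpotentOrbit κ n,
      GLAccess.Accessible O₁ O₂ ↔ GLAccess.ClosureLE O₂ O₁) ∧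
    -- and, in the labelling of the nilpotent orbits by partitions, as the dominance order there
    (Function.Bijective (fun π : n.Partition => GLAccess.orbitOf κ π) ∧
      ∀ π₁ π₂ : n.Partition,
        GLAccess.Accessible (GLAccess.orbitOf κ π₁) (GLAccess.orbitOf κ π₂) ↔
          GLAccess.Dominates π₁ π₂) := by
  exact ⟨fun _ _ => GLAccess.oneAccessible_of_dominates,
    fun _ _ => ⟨fun h => h.closureLE.oneAccessible, .single⟩,
    ⟨fun _ => GLAccess.accessible_iff_closureLE.2 Set.Subset.rfl,
      fun _ _ _ => Relation.TransGen.trans,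
      fun _ _ h₁ h₂ => GLAccess.ClosureLE.antisymm h₁.closureLE h₂.closureLE⟩,
    fun _ _ => GLAccess.accessible_iff_closureLE, GLAccess.orbitOf_bijective,
    fun _ _ => ⟨fun h => GLAccess.dominates_of_closureLE h.closureLE,
      fun h => .single (GLAccess.oneAccessible_of_dominates h)⟩⟩
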